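/- Let $\mathbb G$ be a homogeneous group: a connected, simply connected Lie group whose Lie algebra $\mathfrak g$ is equipped with dilations $D_r=\mathrm{Exp}(A\ln r)$, $r>0$, where $A:\mathfrak g\to\mathfrak g$ is linear and diagonalisable with positive eigenvalues and each $D_r$ preserves the Lie bracket. Write $x\mapsto rx$, $r>0$, for the induced dilations of $\mathbb G$, i.e. the smooth one-parameter group of automorphisms of $\mathbb G$ whose differentials at the identity are the $D_r$. Let $Q=\mathrm{Tr}\,A$ be the homogeneous dimension, and let $L^p(\mathbb G)$ be taken with respect to a Haar measure. Let $|\cdot|$ be any homogeneous quasi-norm on $\mathbb G$: a continuous function $\mathbb G\to[0,\infty)$ with $|x^{-1}|=|x|$, $|rx|=r|x|$ for $r>0$, and $|x|=0$ if and only if $x$ is the identity $0$ of $\mathbb G$. Let $\mathcal R$ be the radial derivative: for $x\neq 0$ and $y=|x|^{-1}x$, $$\mathcal R f(x)=\frac{d}{dr}f(ry)\Big|_{r=|x|}.$$ Let $1<p<\infty$, let $k,m$ be integers $\ge 0$, let $\alpha,\beta\in\mathbb R$ and $\gamma=\alpha+\beta+1$, and assume $$\prod_{j=0}^{m-1}\left|Q-p(\alpha-j)\right|\neq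 0,\qquad \prod_{j=0}^{k-1}\left|Q-p\left(\tfrac{\beta}{p-1}-j\right)\right|\neq 0$$ (empty products are $1$). Put $$\widetilde A_{\alpha,m}=p^{m}\Big[\prod_{j=0}^{m-1}\left|Q-p(\alpha-j)\right|\Big]^{-1},\qquad \widetilde A_{\beta,k}=p^{k(p-1)}\Big[\prod_{j=0}^{k-1}\left|Q-p\left(\tfrac{\beta}{p-1}-j\right)\right|\Big]^{-(p-1)}.$$ Then for every complex-valued $f\in C_0^\infty(\mathbb G\setminus\{0\})$ the three functions below belong to $L^p(\mathbb G)$ and $$\frac{|Q-\gamma|}{p}\left\|\frac{f}{|x|^{\gamma/p}}\right\|_{L^p(\mathbb G)}^{p}\le \widetilde A_{\alpha,m}\,\widetilde A_{\beta,k}\left\|\frac{1}{|x|^{\alpha-m}}\mathcal R^{m+1}f\right\|_{L^p(\mathbb G)}\left\|\frac{1}{|x|^{\frac{\beta}{p-1}-k}}\mathcal R^{k}f\right\|_{L^p(\mathbb G)}^{p-1}.$$ -/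

import Mathlib

open MeasureTheory
open scoped Manifold ContDiff

noncomputable section

/-- The linear map `D_r = Exp(A ln r)` on the Lie algebra of `G`, for a linear map `A`. -/
def lieDilation {E : Type*} [NormedAddCommGroup E] [NormedSpace ℝ E] (G : Type*) [Group G]
    [TopologicalSpace G] [ChartedSpace E G]
    (A : GroupLieAlgebra 𝓘(ℝ, E) G →L[ℝ] GroupLieAlgebra 𝓘(ℝ, E) G) (r : ℝ) :
    GroupLieAlgebra 𝓘(ℝ, E) G →L[ℝ] GroupLieAlgebra 𝓘(ℝ, E) G :=
  (NormedSpace.exp (Real.log r • (A : E →L[ℝ] E)) : E →L[ℝ] E)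

/-- A family of dilations `D_r = Exp(A ln r)`, `r > 0`, of the Lie algebra of `G`:
`A` is diagonalisable with positive eigenvalues and every `D_r` respects the Lie bracket. -/
structure LieAlgebraDilations (E : Type*) [NormedAddCommGroup E] [NormedSpace ℝ E] (G : Type*)
    [Group G] [TopologicalSpace G] [ChartedSpace E G] where
  /-- The generator `A` of the dilations. -/
  A : GroupLieAlgebra 𝓘(ℝ, E) G →L[ℝ] GroupLieAlgebra 𝓘(ℝ, E) G
  /-- There is a basis `X₁, …, Xₙ` with `A X_j = ν_j X_j` and `ν_j > 0`. -/
  diagonalisable_pos : ∃ (n : ℕ) (X : Module.Basis (Fin n) ℝ (GroupLieAlgebra 𝓘(ℝ, E) G))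
    (ν : Fin n → ℝ), ∀ j, 0 < ν j ∧ A (X j) = ν j • X j
  map_lie : ∀ r : ℝ, 0 < r → ∀ X Y : GroupLieAlgebra 𝓘(ℝ, E) G,
    ⁅lieDilation G A r X, lieDilation G A r Y⁆ = lieDilation G A r ⁅X, Y⁆

/-- The structure of a homogeneous group on a (connected, simply connected) Lie group `G`:
a family of dilations of the Lie algebra, together with the dilations `x ↦ r x` of `G` that it
induces, that is, the smooth one-parameter group `(δ_r)_{r > 0}` of automorphisms of `G` whose
differentials at the identity are the dilations `D_r` of the Lie algebra.
The values of `δ r` for `r ≤ 0` are irrelevant. -/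
structure HomogeneousGroupStructure (E : Type*) [NormedAddCommGroup E] [NormedSpace ℝ E]
    (G : Type*) [Group G] [TopologicalSpace G] [ChartedSpace E G]
    extends LieAlgebraDilations E G where
  /-- The dilation `x ↦ r x` of the group. -/
  δ : ℝ → G → G
  δ_one : ∀ x, δ 1 x = x
  δ_mul : ∀ r s : ℝ, 0 < r → 0 < s → ∀ x, δ (r * s) x = δ r (δ s x)
  map_mul : ∀ r : ℝ, 0 < r → ∀ x y, δ r (x * y) = δ r x * δ r y
  smooth : ContMDiffOn (𝓘(ℝ, ℝ).prod 𝓘(ℝ, E)) 𝓘(ℝ, E) ∞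
    (fun q : ℝ × G => δ q.1 q.2) (Set.Ioi 0 ×ˢ Set.univ)
  mfderiv_one : ∀ r : ℝ, 0 < r → ∀ X : GroupLieAlgebra 𝓘(ℝ, E) G,
    (mfderiv 𝓘(ℝ, E) 𝓘(ℝ, E) (δ r) 1 X : E) = lieDilation G A r X

namespace HomogeneousGroupStructure

variable {E : Type*} [NormedAddCommGroup E] [NormedSpace ℝ E]
  {G : Type*} [Group G] [TopologicalSpace G] [ChartedSpace E G]

/-- The homogeneous dimension `Q = Tr A`. -/
def Q (𝔥 : HomogeneousGroupStructure E G) : ℝ :=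
  LinearMap.trace ℝ (GroupLieAlgebra 𝓘(ℝ, E) G) 𝔥.A.toLinearMap

/-- `N = |·|` is a homogeneous quasi-norm: a continuous non-negative function on `G` with
`|x⁻¹| = |x|`, `|r x| = r |x|` for `r > 0`, vanishing exactly at the identity. -/
structure IsQuasiNorm (𝔥 : HomogeneousGroupStructure E G) (N : G → ℝ) : Prop where
  continuous : Continuous N
  nonneg : ∀ x, 0 ≤ N x
  inv : ∀ x, N x⁻¹ = N x
  homogeneous : ∀ r : ℝ, 0 < r → ∀ x, N (𝔥.δ r x) = r * N x
  eq_zero_iff : ∀ x, N x = 0 ↔ x = 1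

/-- The radial derivative: `(𝓡 f)(x)` is the derivative of `r ↦ f (r y)` at `r = |x|`,
where `y = |x|⁻¹ x` is the point of the unit pseudo-sphere on the dilation orbit of `x ≠ 1`
(so that `r y = (r / |x|) x`). -/
def radialDeriv (𝔥 : HomogeneousGroupStructure E G) (N : G → ℝ) (f : G → ℂ) : G → ℂ :=
  fun x => deriv (fun r : ℝ => f (𝔥.δ (r / N x) x)) (N x)

end HomogeneousGroupStructure

/-- `C₀^∞(G ∖ {1})`: smooth complex-valued functions with compact support not containing the
identity element of `G`. -/
def IsTestFunctionOffIdentity (E : Type*) [NormedAddCommGroup E] [NormedSpace ℝ E] {G : Type*}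
    [Group G] [TopologicalSpace G] [ChartedSpace E G] (f : G → ℂ) : Prop :=
  ContMDiff 𝓘(ℝ, E) 𝓘(ℝ, ℂ) ∞ f ∧ HasCompactSupport f ∧ (1 : G) ∉ tsupport f

/-- The function `f / |x|^s`. -/
def divWeight {G : Type*} (N : G → ℝ) (s : ℝ) (f : G → ℂ) : G → ℂ :=
  fun x => f x / ((N x ^ s : ℝ) : ℂ)

/-- The `L^p` norm of a function, as a real number; it is meaningful for functions in `L^p`. -/
def realLpNorm {G : Type*} [MeasurableSpace G] (p : ℝ) (μ : Measure G) (f : G → ℂ) : ℝ :=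
  (eLpNorm f (ENNReal.ofReal p) μ).toReal

end

/-!
Write `𝔼 u (x) = d/ds u(s x) |_{s = 1}` for the Euler operator of the dilations, so that
`𝔼 = |x| 𝓡` off the identity.

The analytic heart is the identity `∫ 𝔼 φ = -Q ∫ φ` for compactly supported `φ`
(`HomogeneousGroupStructure.integral_euler_eq`), obtained by differentiating the scaling law
`∫ φ(s x) dx = s ^ (-Q) ∫ φ(x) dx` at `s = 1`. For `φ = |f|^p |x|^(-γ)` it reads
`(γ - Q) ∫ |f|^p |x|^(-γ) = ∫ p |f|^(p - 2) Re(conj f · 𝓡 f) |x|^(1 - γ)`, and Hölder's inequality,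
applied with `1 - γ = -α - β`, yields the inequality for `m = k = 0`
(`IsQuasiNorm.caffarelliKohnNirenberg`). Replacing `(α, β)` by `(α - 1, α (p - 1))` there gives the
weighted Hardy inequality `|Q - p α| ‖f / |x|^α‖ ≤ p ‖𝓡 f / |x|^(α - 1)‖` (`IsQuasiNorm.hardy`).
Iterating it `m` times on `𝓡 f` and `k` times on `f` gives the general inequality. The quasi-norm is only
continuous, hence `𝓡 f` need not be smooth; the iteration stays inside the class of functions
`|x|^a u` with `u ∈ C₀^∞(G ∖ {1})`, on which `𝓡 (|x|^a u) = |x|^(a - 1) (𝔼 u + a u)`.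

The scaling law itself is geometric (`HomogeneousGroupStructure.map_δ_haar`). A dilation is an
automorphism, hence multiplies Haar measure by some constant, which has to be identified with
`det D_s = s ^ Q`. Near the identity, Haar measure is, up to a factor arbitrarily close to `1`,
a multiple of Lebesgue measure in a chart (`exists_nhds_haar_comparable_chart`),
and in the chart the infinitesimal volume distortion is at most the determinant of the
differential. This bounds the constant by `det D_s` (`haar_scaling_le_abs_det`); the same bound for
the inverse dilation makes it an equality.
-/

section

open Filter Topology
open scoped NNReal ENNReal

/-! ### Haar measure and Lebesgue measure in a chart at the identity -/

/-- Infinitesimally at `x₀`, and read in a chart, `Φ` expands Lebesgue measure by at most the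
determinant of its differential. -/
theorem exists_nhds_measure_chart_image_le
    {E : Type*} [NormedAddCommGroup E] [NormedSpace ℝ E] [FiniteDimensional ℝ E]
    [MeasurableSpace E] [BorelSpace E] (ν : Measure E) [ν.IsAddHaarMeasure]
    {X : Type*} [TopologicalSpace X] (φ : OpenPartialHomeomorph X E) {x₀ : X}
    (hx₀ : x₀ ∈ φ.source) (Φ : X → X) (D : E →L[ℝ] E)
    (hΦ : HasStrictFDerivAt (fun u => φ (Φ (φ.symm u))) D (φ x₀))
    {m : ℝ≥0} (hm : ENNReal.ofReal |D.det| < m) :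
    ∃ V ∈ 𝓝 x₀, ∀ B ⊆ V, ν (φ '' (Φ '' B)) ≤ m * ν (φ '' B) := by
  obtain ⟨δ, hδ, hδ0⟩ := ((addHaar_image_le_mul_of_det_lt ν D hm).and
    self_mem_nhdsWithin).exists
  obtain ⟨S, hS, hSa⟩ := hΦ.approximates_deriv_on_nhds (Or.inr hδ0)
  refine ⟨φ.source ∩ φ ⁻¹' S, inter_mem (φ.open_source.mem_nhds hx₀)
    ((φ.continuousAt hx₀).preimage_mem_nhds hS), fun B hB => ?_⟩
  have hBS : φ '' B ⊆ S := by
    rintro _ ⟨b, hb, rfl⟩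
    exact (hB hb).2
  have h1 := hδ (φ '' B) _ (hSa.mono_set hBS)
  have h2 : φ '' (Φ '' B) = (fun u => φ (Φ (φ.symm u))) '' (φ '' B) := by
    rw [Set.image_image, Set.image_image]
    refine Set.image_congr fun b hb => ?_
    simp only [φ.left_inv (hB hb).1]
  rwa [h2]

/-- Lebesgue measure of a chart at the identity is almost invariant under left and right
translations by elements close to the identity, since the multiplication `(u, v) ↦ u v`, read in the
chart, has strict differential `(u, v) ↦ u + v`. -/
theorem exists_nhds_measure_chart_translate_le
    {E : Type*} [NormedAddCommGroup E] [NormedSpace ℝ E] [FiniteDimensional ℝ E]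
    [MeasurableSpace E] [BorelSpace E] (ν : Measure E) [ν.IsAddHaarMeasure]
    {G : Type*} [Group G] [TopologicalSpace G] (φ : OpenPartialHomeomorph G E)
    (h1 : (1 : G) ∈ φ.source)
    (hM : HasStrictFDerivAt (fun q : E × E => φ (φ.symm q.1 * φ.symm q.2))
      (ContinuousLinearMap.fst ℝ E E + ContinuousLinearMap.snd ℝ E E) (φ 1, φ 1))
    {η : ℝ≥0} (hη : 1 < η) :
    ∃ W ∈ 𝓝 (1 : G), ∀ x ∈ W, ∀ B ⊆ W,
      ν (φ '' ((fun y => x * y) '' B)) ≤ η * ν (φ '' B) ∧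
      ν (φ '' ((fun y => y * x) '' B)) ≤ η * ν (φ '' B) := by
  have hdet : ENNReal.ofReal |(ContinuousLinearMap.id ℝ E).det| < η := by
    simpa [ContinuousLinearMap.det] using hη
  obtain ⟨δ, hδ, hδ0⟩ := ((addHaar_image_le_mul_of_det_lt ν _ hdet).and
    self_mem_nhdsWithin).exists
  obtain ⟨S, hS, hSa⟩ := hM.approximates_deriv_on_nhds (Or.inr hδ0)
  rw [nhds_prod_eq] at hS
  obtain ⟨U, hU, hUS⟩ := mem_prod_same_iff.1 hS
  refine ⟨φ.source ∩ φ ⁻¹' U, inter_mem (φ.open_source.mem_nhds h1)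
    ((φ.continuousAt h1).preimage_mem_nhds hU), fun x hx B hB => ?_⟩
  have hBU : φ '' B ⊆ U := by
    rintro _ ⟨b, hb, rfl⟩
    exact (hB hb).2
  constructor
  · have ha : ApproximatesLinearOn (fun u => φ (x * φ.symm u)) (ContinuousLinearMap.id ℝ E)
        (φ '' B) δ := by
      intro u hu v hv
      have := hSa (φ x, u) (hUS ⟨hx.2, hBU hu⟩) (φ x, v) (hUS ⟨hx.2, hBU hv⟩)
      simpa [φ.left_inv hx.1, Prod.norm_def] using this
    have h3 := hδ _ _ ha
    rw [Set.image_image] at h3 ⊢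
    refine le_of_eq_of_le (congrArg ν (Set.image_congr fun b hb => ?_)) h3
    simp only [φ.left_inv (hB hb).1]
  · have ha : ApproximatesLinearOn (fun u => φ (φ.symm u * x)) (ContinuousLinearMap.id ℝ E)
        (φ '' B) δ := by
      intro u hu v hv
      have := hSa (u, φ x) (hUS ⟨hBU hu, hx.2⟩) (v, φ x) (hUS ⟨hBU hv, hx.2⟩)
      simpa [φ.left_inv hx.1, Prod.norm_def] using this
    have h3 := hδ _ _ ha
    rw [Set.image_image] at h3 ⊢
    refine le_of_eq_of_le (congrArg ν (Set.image_congr fun b hb => ?_)) h3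
    simp only [φ.left_inv (hB hb).1]

/-- Near the identity a Haar measure is, up to a factor arbitrarily close to `1`, a constant
multiple `b / a` of Lebesgue measure of the chart. This is the uniqueness argument for Haar measure,
run with the chart measure `λ`, which is only almost invariant: for a small symmetric open set `V`,
Fubini gives `∫_B λ(x V) dμ(x) = ∫_V λ(B x⁻¹) dμ(x)`, and the two integrands are nearly `λ(V)` and
`λ(B)`. -/
theorem exists_nhds_haar_comparable_chart
    {E : Type*} [NormedAddCommGroup E] [NormedSpace ℝ E] [FiniteDimensional ℝ E]
    [MeasurableSpace E] [BorelSpace E] (ν : Measure E) [ν.IsAddHaarMeasure]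
    {G : Type*} [Group G] [TopologicalSpace G] [IsTopologicalGroup G]
    [SecondCountableTopology G] [LocallyCompactSpace G]
    [MeasurableSpace G] [BorelSpace G] (μ : Measure G) [μ.IsHaarMeasure]
    (φ : OpenPartialHomeomorph G E) (h1 : (1 : G) ∈ φ.source)
    (hM : HasStrictFDerivAt (fun q : E × E => φ (φ.symm q.1 * φ.symm q.2))
      (ContinuousLinearMap.fst ℝ E E + ContinuousLinearMap.snd ℝ E E) (φ 1, φ 1))
    {η : ℝ≥0} (hη : 1 < η) :
    ∃ a b : ℝ≥0∞, a ≠ 0 ∧ a ≠ ⊤ ∧ b ≠ 0 ∧ b ≠ ⊤ ∧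
      ∃ V ∈ 𝓝 (1 : G), ∀ B ⊆ V, MeasurableSet B →
        a * μ B ≤ η ^ 2 * (b * ν (φ '' B)) ∧ b * ν (φ '' B) ≤ η ^ 2 * (a * μ B) := by
  obtain ⟨W₀, hW₀, hW₀t⟩ := exists_nhds_measure_chart_translate_le ν φ h1 hM hη
  obtain ⟨K, hK, hK1⟩ := exists_compact_mem_nhds (1 : G)
  set W := W₀ ∩ φ.source ∩ K ∩ φ ⁻¹' Metric.ball (φ 1) 1 with hW
  have hWn : W ∈ 𝓝 (1 : G) :=
    inter_mem (inter_mem (inter_mem hW₀ (φ.open_source.mem_nhds h1)) hK1)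
      ((φ.continuousAt h1).preimage_mem_nhds (Metric.ball_mem_nhds _ one_pos))
  obtain ⟨V, hVo, hV1, hVi, hVW⟩ := exists_open_nhds_one_mul_subset hWn |>.elim
    fun V hV => show ∃ V : Set G, IsOpen V ∧ (1 : G) ∈ V ∧ (∀ x ∈ V, x⁻¹ ∈ V) ∧
        ∀ x ∈ V, ∀ y ∈ V, x * y ∈ W from by
      refine ⟨V ∩ V⁻¹, hV.1.inter hV.1.inv, ⟨hV.2.1, by simpa using hV.2.1⟩, ?_, ?_⟩
      · rintro x ⟨hx, hx'⟩
        exact ⟨hx', by simpa using hx⟩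
      · rintro x ⟨hx, -⟩ y ⟨hy, -⟩
        exact hV.2.2 (Set.mul_mem_mul hx hy)
  have hVsub : V ⊆ W := fun x hx => by simpa using hVW x hx 1 hV1
  -- Lebesgue measure of the chart, transported to the group
  set lam : Measure G := (ν.restrict φ.target).map φ.symm with hlam
  have hae : AEMeasurable φ.symm (ν.restrict φ.target) :=
    φ.continuousOn_symm.aemeasurable φ.open_target.measurableSet
  have hlamB : ∀ B : Set G, MeasurableSet B → B ⊆ φ.source → lam B = ν (φ '' B) := by
    intro B hB hBs
    rw [hlam, Measure.map_apply_of_aemeasurable hae hB, φ.image_eq_target_inter_inv_preimage hBs,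
      Measure.restrict_apply₀ (hae.nullMeasurableSet_preimage hB), Set.inter_comm]
  have hmulL : ∀ (x : G) (B : Set G), MeasurableSet B →
      MeasurableSet ((fun y => x * y) '' B) := fun x B hB => by
    rw [Set.image_mul_left]
    exact measurable_const_mul _ hB
  have hmulR : ∀ (x : G) (B : Set G), MeasurableSet B →
      MeasurableSet ((fun y => y * x) '' B) := fun x B hB => by
    rw [Set.image_mul_right]
    exact measurable_mul_const _ hB
  have : SFinite lam := by rw [hlam]; infer_instance
  have hVm : MeasurableSet V := hVo.measurableSet
  have hVsrc : V ⊆ φ.source := fun x hx => (hVsub hx).1.1.2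
  have key : ∀ B ⊆ V, MeasurableSet B →
      ∫⁻ x in B, lam ((fun y => x * y) '' V) ∂μ = ∫⁻ x in V, lam ((fun y => y * x⁻¹) '' B) ∂μ := by
    intro B hB hBm
    -- by Fubini the two sides are the `lam × μ`-measures of `{(y, x) | x ∈ B, y⁻¹ x ∈ V}` (where
    -- `V = V⁻¹` is used) and of `{(y, x) | y x ∈ B, x ∈ V}`; for fixed `y` the slice of the latter
    -- is the left translate by `y⁻¹` of the slice of the former
    have hS : MeasurableSet {q : G × G | q.2 ∈ B ∧ q.1⁻¹ * q.2 ∈ V} :=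
      (measurable_snd hBm).inter ((measurable_fst.inv.mul measurable_snd) hVm)
    have hS' : MeasurableSet {q : G × G | q.1 * q.2 ∈ B ∧ q.2 ∈ V} :=
      ((measurable_fst.mul measurable_snd) hBm).inter (measurable_snd hVm)
    have e1 : ∫⁻ x in B, lam ((fun y => x * y) '' V) ∂μ =
        (lam.prod μ) {q : G × G | q.2 ∈ B ∧ q.1⁻¹ * q.2 ∈ V} := by
      rw [Measure.prod_apply_symm hS, ← lintegral_indicator hBm]
      refine lintegral_congr fun x => ?_
      by_cases hx : x ∈ B
      · rw [Set.indicator_of_mem hx]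
        congr 1
        ext y
        simp only [Set.image_mul_left, Set.mem_preimage, Set.mem_ofPred_eq, hx, true_and]
        constructor
        · intro h
          simpa using hVi _ h
        · intro h
          simpa using hVi _ h
      · rw [Set.indicator_of_notMem hx]
        simp [hx]
    have e2 : ∫⁻ x in V, lam ((fun y => y * x⁻¹) '' B) ∂μ =
        (lam.prod μ) {q : G × G | q.1 * q.2 ∈ B ∧ q.2 ∈ V} := by
      rw [Measure.prod_apply_symm hS', ← lintegral_indicator hVm]
      refine lintegral_congr fun x => ?_
      by_cases hx : x ∈ V
      · rw [Set.indicator_of_mem hx]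
        congr 1
        ext y
        simp [Set.image_mul_right, hx]
      · rw [Set.indicator_of_notMem hx]
        simp [hx]
    rw [e1, e2, Measure.prod_apply hS, Measure.prod_apply hS']
    refine lintegral_congr fun y => ?_
    rw [← measure_preimage_mul μ y]
    congr 1
    ext x
    simp
  refine ⟨lam V, μ V, ?_, ?_, ?_, ?_, V, hVo.mem_nhds hV1, fun B hB hBm => ?_⟩
  · rw [hlamB V hVm hVsrc]
    exact ((φ.isOpen_image_of_subset_source hVo hVsrc).measure_pos ν ⟨_, 1, hV1, rfl⟩).ne'
  · rw [hlamB V hVm hVsrc]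
    refine ((measure_mono ?_).trans_lt (measure_ball_lt_top (μ := ν) (x := φ 1) (r := 1))).ne
    rintro _ ⟨b, hb, rfl⟩
    exact (hVsub hb).2
  · exact (hVo.measure_pos μ ⟨1, hV1⟩).ne'
  · exact ((measure_mono fun x hx => (hVsub hx).1.2).trans_lt hK.measure_lt_top).ne
  have hBs := hB.trans hVsrc
  have hVW₀ : V ⊆ W₀ := fun x hx => (hVsub hx).1.1.1
  have L1 : ∀ x ∈ B, lam ((fun y => x * y) '' V) ≤ η * lam V ∧
      lam V ≤ η * lam ((fun y => x * y) '' V) := by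
    intro x hx
    have hsub : (fun y => x * y) '' V ⊆ W := by
      rintro _ ⟨y, hy, rfl⟩
      exact hVW x (hB hx) y hy
    have hm := hmulL x V hVm
    rw [hlamB V hVm hVsrc, hlamB _ hm fun y hy => (hsub hy).1.1.2]
    refine ⟨(hW₀t x (hVW₀ (hB hx)) V hVW₀).1, ?_⟩
    have := (hW₀t x⁻¹ (hVW₀ (hVi x (hB hx))) _ fun y hy => (hsub hy).1.1.1).1
    rw [Set.image_image (fun y => x⁻¹ * y)] at this
    simpa only [inv_mul_cancel_left, Set.image_id'] using this
  have L2 : ∀ x ∈ V, lam ((fun y => y * x⁻¹) '' B) ≤ η * lam B ∧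
      lam B ≤ η * lam ((fun y => y * x⁻¹) '' B) := by
    intro x hx
    have hsub : (fun y => y * x⁻¹) '' B ⊆ W := by
      rintro _ ⟨y, hy, rfl⟩
      exact hVW y (hB hy) _ (hVi x hx)
    have hm := hmulR x⁻¹ B hBm
    rw [hlamB B hBm hBs, hlamB _ hm fun y hy => (hsub hy).1.1.2]
    refine ⟨(hW₀t x⁻¹ (hVW₀ (hVi x hx)) B (hB.trans hVW₀)).2, ?_⟩
    have := (hW₀t x (hVW₀ hx) _ fun y hy => (hsub hy).1.1.1).2
    rw [Set.image_image (fun y => y * x)] at this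
    simpa only [inv_mul_cancel_right, Set.image_id'] using this
  have hηt : (η : ℝ≥0∞) ≠ ⊤ := ENNReal.coe_ne_top
  rw [← hlamB B hBm hBs]
  constructor
  · calc lam V * μ B = ∫⁻ _ in B, lam V ∂μ := by rw [setLIntegral_const]
      _ ≤ ∫⁻ x in B, η * lam ((fun y => x * y) '' V) ∂μ :=
        setLIntegral_mono' hBm fun x hx => (L1 x hx).2
      _ = η * ∫⁻ x in B, lam ((fun y => x * y) '' V) ∂μ := lintegral_const_mul' _ _ hηt
      _ = η * ∫⁻ x in V, lam ((fun y => y * x⁻¹) '' B) ∂μ := by rw [key B hB hBm]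
      _ ≤ η * ∫⁻ _ in V, η * lam B ∂μ :=
        mul_le_mul' le_rfl (setLIntegral_mono' hVm fun x hx => (L2 x hx).1)
      _ = η ^ 2 * (μ V * lam B) := by rw [setLIntegral_const]; ring
  · calc μ V * lam B = ∫⁻ _ in V, lam B ∂μ := by rw [setLIntegral_const, mul_comm]
      _ ≤ ∫⁻ x in V, η * lam ((fun y => y * x⁻¹) '' B) ∂μ :=
        setLIntegral_mono' hVm fun x hx => (L2 x hx).2
      _ = η * ∫⁻ x in V, lam ((fun y => y * x⁻¹) '' B) ∂μ := lintegral_const_mul' _ _ hηt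
      _ = η * ∫⁻ x in B, lam ((fun y => x * y) '' V) ∂μ := by rw [key B hB hBm]
      _ ≤ η * ∫⁻ _ in B, η * lam V ∂μ :=
        mul_le_mul' le_rfl (setLIntegral_mono' hBm fun x hx => (L1 x hx).1)
      _ = η ^ 2 * (lam V * μ B) := by rw [setLIntegral_const]; ring

/-- A homeomorphism fixing the identity that multiplies Haar measure by a constant `c` satisfies
`c ≤ |det|` of its differential at the identity. Applied also to the inverse map this gives
equality. -/
theorem haar_scaling_le_abs_det
    {E : Type*} [NormedAddCommGroup E] [NormedSpace ℝ E] [FiniteDimensional ℝ E]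
    {G : Type*} [Group G] [TopologicalSpace G] [IsTopologicalGroup G]
    [SecondCountableTopology G] [LocallyCompactSpace G]
    [MeasurableSpace G] [BorelSpace G] (μ : Measure G) [μ.IsHaarMeasure]
    (φ : OpenPartialHomeomorph G E) (h1 : (1 : G) ∈ φ.source)
    (hM : HasStrictFDerivAt (fun q : E × E => φ (φ.symm q.1 * φ.symm q.2))
      (ContinuousLinearMap.fst ℝ E E + ContinuousLinearMap.snd ℝ E E) (φ 1, φ 1))
    (Φ : G ≃ₜ G) (hΦ1 : Φ 1 = 1) (D : E →L[ℝ] E)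
    (hΦ : HasStrictFDerivAt (fun u => φ (Φ (φ.symm u))) D (φ 1))
    (c : ℝ≥0) (hc : ∀ B : Set G, MeasurableSet B → μ (Φ '' B) = c * μ B) :
    (c : ℝ) ≤ |D.det| := by
  borelize E
  let ν : Measure E := Measure.addHaar
  have main : ∀ η : ℝ≥0, 1 < η → ∀ m : ℝ≥0, |D.det| < m → c ≤ η ^ 4 * m := by
    intro η hη m hm
    have hm' : ENNReal.ofReal |D.det| < m := by
      rw [← ENNReal.ofReal_coe_nnreal]
      exact (ENNReal.ofReal_lt_ofReal_iff_of_nonneg (abs_nonneg _)).2 hm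
    obtain ⟨a, b, ha, ha', hb, hb', V, hV, hVab⟩ :=
      exists_nhds_haar_comparable_chart ν μ φ h1 hM hη
    obtain ⟨U, hU, hUm⟩ := exists_nhds_measure_chart_image_le ν φ h1 Φ D hΦ hm'
    obtain ⟨K, hK, hK1⟩ := exists_compact_mem_nhds (1 : G)
    have hpre : Φ ⁻¹' V ∈ 𝓝 (1 : G) :=
      Φ.continuous.continuousAt.preimage_mem_nhds (by rwa [hΦ1])
    obtain ⟨B, hBsub, hBo, hB1⟩ := mem_nhds_iff.1
      (inter_mem (inter_mem (inter_mem hV hpre) hU) hK1)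
    have hBm := hBo.measurableSet
    have hΦB : MeasurableSet (Φ '' B) := (Φ.isOpenMap _ hBo).measurableSet
    have hμ0 : μ B ≠ 0 := (hBo.measure_pos μ ⟨1, hB1⟩).ne'
    have hμt : μ B ≠ ⊤ := ((measure_mono fun x hx => (hBsub hx).2).trans_lt hK.measure_lt_top).ne
    have hfin : (a * μ B) * c ≤ (a * μ B) * (η ^ 4 * m : ℝ≥0) := by
      calc (a * μ B) * c = a * μ (Φ '' B) := by rw [hc B hBm]; ring
        _ ≤ η ^ 2 * (b * ν (φ '' (Φ '' B))) :=
          (hVab _ (by rintro _ ⟨x, hx, rfl⟩; exact (hBsub hx).1.1.2) hΦB).1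
        _ ≤ η ^ 2 * (b * (m * ν (φ '' B))) := by
          gcongr
          exact hUm B fun x hx => (hBsub hx).1.2
        _ = η ^ 2 * m * (b * ν (φ '' B)) := by ring
        _ ≤ η ^ 2 * m * (η ^ 2 * (a * μ B)) :=
          mul_le_mul' le_rfl (hVab B (fun x hx => (hBsub hx).1.1.1) hBm).2
        _ = (a * μ B) * (η ^ 4 * m : ℝ≥0) := by push_cast; ring
    exact_mod_cast (ENNReal.mul_le_mul_iff_right (mul_ne_zero ha hμ0)
      (ENNReal.mul_ne_top ha' hμt)).1 hfin
  have step : ∀ m : ℝ≥0, |D.det| < m → (c : ℝ) ≤ m := by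
    intro m hm
    have ht : Tendsto (fun η : ℝ => η ^ 4 * (m : ℝ)) (𝓝[>] 1) (𝓝 (1 ^ 4 * m)) :=
      (((continuous_id.pow 4).mul continuous_const).tendsto (1 : ℝ)).mono_left nhdsWithin_le_nhds
    rw [one_pow, one_mul] at ht
    refine ge_of_tendsto ht ?_
    filter_upwards [self_mem_nhdsWithin] with η hη
    have hη' : (1 : ℝ) < η := hη
    lift η to ℝ≥0 using by linarith
    exact_mod_cast main η (by exact_mod_cast hη') m hm
  refine le_of_forall_gt_imp_ge_of_dense fun m hm => ?_
  lift m to ℝ≥0 using (abs_nonneg _).trans hm.le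
  exact step m hm

theorem LieGroup.hasStrictFDerivAt_mul_chart
    {E : Type*} [NormedAddCommGroup E] [NormedSpace ℝ E]
    {G : Type*} [Group G] [TopologicalSpace G] [ChartedSpace E G] [LieGroup 𝓘(ℝ, E) ∞ G] :
    HasStrictFDerivAt
      (fun q : E × E => chartAt E (1 : G) ((chartAt E (1 : G)).symm q.1 *
        (chartAt E (1 : G)).symm q.2))
      (ContinuousLinearMap.fst ℝ E E + ContinuousLinearMap.snd ℝ E E)
      (chartAt E (1 : G) 1, chartAt E (1 : G) 1) := by
  set φ := chartAt E (1 : G) with hφ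
  have h1 : (1 : G) ∈ φ.source := mem_chart_source E 1
  have hsymm : ContMDiffAt 𝓘(ℝ, E) 𝓘(ℝ, E) ∞ φ.symm (φ 1) :=
    contMDiffOn_chart_symm.contMDiffAt (φ.open_target.mem_nhds (φ.map_source h1))
  have hchart : ContMDiffAt 𝓘(ℝ, E) 𝓘(ℝ, E) ∞ φ 1 :=
    contMDiffOn_chart.contMDiffAt (φ.open_source.mem_nhds h1)
  have ha : ContMDiffAt 𝓘(ℝ, E × E) 𝓘(ℝ, E) ∞ (fun q : E × E => φ.symm q.1) (φ 1, φ 1) :=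
    ContMDiffAt.comp (φ 1, φ 1) (g := φ.symm) (f := Prod.fst) hsymm contDiffAt_fst.contMDiffAt
  have hb : ContMDiffAt 𝓘(ℝ, E × E) 𝓘(ℝ, E) ∞ (fun q : E × E => φ.symm q.2) (φ 1, φ 1) :=
    ContMDiffAt.comp (φ 1, φ 1) (g := φ.symm) (f := Prod.snd) hsymm contDiffAt_snd.contMDiffAt
  have hm : ContMDiffAt 𝓘(ℝ, E × E) 𝓘(ℝ, E) ∞
      (fun q : E × E => φ (φ.symm q.1 * φ.symm q.2)) (φ 1, φ 1) := by
    refine ContMDiffAt.comp (φ 1, φ 1) (g := φ) (f := fun q : E × E => φ.symm q.1 * φ.symm q.2)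
      ?_ (ha.mul hb)
    simpa [φ.left_inv h1] using hchart
  have hs := (contMDiffAt_iff_contDiffAt.1 hm).hasStrictFDerivAt (by simp)
  set M := fun q : E × E => φ (φ.symm q.1 * φ.symm q.2) with hMdef
  have htar : ∀ᶠ u in 𝓝 (φ 1), u ∈ φ.target := φ.open_target.mem_nhds (φ.map_source h1)
  have hl : HasFDerivAt (fun u : E => M (u, φ 1)) (ContinuousLinearMap.id ℝ E) (φ 1) := by
    refine (hasFDerivAt_id (φ 1)).congr_of_eventuallyEq ?_
    filter_upwards [htar] with u hu
    simp [hMdef, φ.left_inv h1, φ.right_inv hu]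
  have hr : HasFDerivAt (fun u : E => M (φ 1, u)) (ContinuousLinearMap.id ℝ E) (φ 1) := by
    refine (hasFDerivAt_id (φ 1)).congr_of_eventuallyEq ?_
    filter_upwards [htar] with u hu
    simp [hMdef, φ.left_inv h1, φ.right_inv hu]
  have hl' := HasFDerivAt.comp (g := M) (f := fun u : E => (u, φ 1)) (φ 1) hs.hasFDerivAt
    (hasFDerivAt_prodMk_left (𝕜 := ℝ) (φ 1) (φ 1))
  have hr' := HasFDerivAt.comp (g := M) (f := fun u : E => (φ 1, u)) (φ 1) hs.hasFDerivAt
    (hasFDerivAt_prodMk_right (𝕜 := ℝ) (φ 1) (φ 1))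
  have hD : ContinuousLinearMap.fst ℝ E E + ContinuousLinearMap.snd ℝ E E =
      fderiv ℝ M (φ 1, φ 1) := by
    refine ContinuousLinearMap.ext fun q => ?_
    have e1 := DFunLike.congr_fun (hl'.unique hl) q.1
    have e2 := DFunLike.congr_fun (hr'.unique hr) q.2
    simp only [ContinuousLinearMap.comp_apply, ContinuousLinearMap.inl_apply,
      ContinuousLinearMap.inr_apply, ContinuousLinearMap.id_apply] at e1 e2
    have e3 : q = (q.1, 0) + (0, q.2) := by simp
    conv_rhs => rw [e3, map_add, e1, e2]
    simp
  rwa [hD]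

/-! ### The determinant of the dilations of the Lie algebra -/

theorem exp_apply_of_apply_eq_smul {E : Type*} [NormedAddCommGroup E] [NormedSpace ℝ E]
    [CompleteSpace E] (L : E →L[ℝ] E) (v : E) (ν : ℝ) (h : L v = ν • v) :
    NormedSpace.exp L v = Real.exp ν • v := by
  have hpow : ∀ n : ℕ, (L ^ n) v = ν ^ n • v := by
    intro n
    induction n with
    | zero => simp
    | succ n ih => rw [pow_succ, mul_apply_eq_comp, h, map_smul, ih, smul_smul,
        pow_succ, mul_comm]
  have h1 := (ContinuousLinearMap.apply ℝ E v).hasSum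
    (NormedSpace.exp_series_hasSum_exp' (𝕂 := ℝ) L)
  have h2 := (NormedSpace.exp_series_hasSum_exp' (𝕂 := ℝ) ν).smul_const v
  rw [← Real.exp_eq_exp_ℝ] at h2
  refine h1.unique (h2.congr_fun ?_)
  intro n
  simp [hpow, smul_smul]

theorem det_exp_smul_eq_exp_mul_trace {E : Type*} [NormedAddCommGroup E] [NormedSpace ℝ E]
    [CompleteSpace E] (A : E →L[ℝ] E) {n : ℕ} (X : Module.Basis (Fin n) ℝ E) (ν : Fin n → ℝ)
    (h : ∀ j, A (X j) = ν j • X j) (t : ℝ) :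
    (NormedSpace.exp (t • A)).det = Real.exp (t * LinearMap.trace ℝ E A.toLinearMap) := by
  have h1 : LinearMap.toMatrix X X A.toLinearMap = Matrix.diagonal ν := by
    ext i j
    simp [LinearMap.toMatrix_apply, h, Matrix.diagonal_apply, Finsupp.single_apply, eq_comm]
    grind
  have h2 : LinearMap.toMatrix X X (NormedSpace.exp (t • A)).toLinearMap =
      Matrix.diagonal fun j => Real.exp (t * ν j) := by
    ext i j
    have := exp_apply_of_apply_eq_smul (t • A) (X j) (t * ν j) (by simp [h, smul_smul])
    simp [LinearMap.toMatrix_apply, this, Matrix.diagonal_apply, Finsupp.single_apply, eq_comm]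
    grind
  rw [LinearMap.trace_eq_matrix_trace ℝ X, h1, ContinuousLinearMap.det,
    ← LinearMap.det_toMatrix X, h2, Matrix.det_diagonal, Matrix.trace_diagonal, Finset.mul_sum,
    Real.exp_sum]

/-! ### Scaling of Haar measure under dilations -/

namespace HomogeneousGroupStructure

section

variable {E : Type*} [NormedAddCommGroup E] [NormedSpace ℝ E]
  {G : Type*} [Group G] [TopologicalSpace G] [ChartedSpace E G]
  (𝔥 : HomogeneousGroupStructure E G)

theorem δ_apply_one {r : ℝ} (hr : 0 < r) : 𝔥.δ r 1 = 1 := by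
  have := 𝔥.map_mul r hr 1 1
  simpa using this

theorem δ_inv_δ {r : ℝ} (hr : 0 < r) (x : G) : 𝔥.δ r⁻¹ (𝔥.δ r x) = x := by
  rw [← 𝔥.δ_mul _ _ (inv_pos.2 hr) hr, inv_mul_cancel₀ hr.ne', 𝔥.δ_one]

theorem δ_δ_inv {r : ℝ} (hr : 0 < r) (x : G) : 𝔥.δ r (𝔥.δ r⁻¹ x) = x := by
  rw [← 𝔥.δ_mul _ _ hr (inv_pos.2 hr), mul_inv_cancel₀ hr.ne', 𝔥.δ_one]

theorem contMDiff_δ {r : ℝ} (hr : 0 < r) : ContMDiff 𝓘(ℝ, E) 𝓘(ℝ, E) ∞ (𝔥.δ r) := by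
  intro x
  have h1 : ContMDiffAt (𝓘(ℝ, ℝ).prod 𝓘(ℝ, E)) 𝓘(ℝ, E) ∞
      (fun q : ℝ × G => 𝔥.δ q.1 q.2) (r, x) :=
    𝔥.smooth.contMDiffAt ((isOpen_Ioi.prod isOpen_univ).mem_nhds ⟨hr, trivial⟩)
  exact h1.comp x (contMDiffAt_const.prodMk contMDiffAt_id)

/-- The dilation by `r > 0` as a homeomorphism of the group. -/
noncomputable def dilationHomeomorph {r : ℝ} (hr : 0 < r) : G ≃ₜ G where
  toFun := 𝔥.δ r
  invFun := 𝔥.δ r⁻¹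
  left_inv := 𝔥.δ_inv_δ hr
  right_inv := 𝔥.δ_δ_inv hr
  continuous_toFun := (𝔥.contMDiff_δ hr).continuous
  continuous_invFun := (𝔥.contMDiff_δ (inv_pos.2 hr)).continuous

theorem abs_det_lieDilation [FiniteDimensional ℝ E] {r : ℝ} (hr : 0 < r) :
    |ContinuousLinearMap.det (lieDilation G 𝔥.A r : E →L[ℝ] E)| = r ^ 𝔥.Q := by
  have : CompleteSpace E := FiniteDimensional.complete ℝ E
  obtain ⟨n, X, ν, h⟩ := 𝔥.diagonalisable_pos
  have h1 := det_exp_smul_eq_exp_mul_trace (E := E) 𝔥.A X ν (fun j => (h j).2) (Real.log r)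
  have h2 : ContinuousLinearMap.det (lieDilation G 𝔥.A r : E →L[ℝ] E) =
    Real.exp (Real.log r * 𝔥.Q) := h1
  rw [h2, abs_of_pos (Real.exp_pos _), Real.rpow_def_of_pos hr]

end

section

variable {E : Type*} [NormedAddCommGroup E] [NormedSpace ℝ E]
  {G : Type*} [Group G] [TopologicalSpace G] [ChartedSpace E G] [LieGroup 𝓘(ℝ, E) ∞ G]
  (𝔥 : HomogeneousGroupStructure E G)

/-- In the chart at the identity the dilation of the group has differential `D_r`. -/
theorem hasStrictFDerivAt_δ_chart {r : ℝ} (hr : 0 < r) :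
    HasStrictFDerivAt
      (fun u : E => chartAt E (1 : G) (𝔥.δ r ((chartAt E (1 : G)).symm u)))
      (lieDilation G 𝔥.A r : E →L[ℝ] E) (chartAt E (1 : G) 1) := by
  set φ := chartAt E (1 : G) with hφ
  have h1 : (1 : G) ∈ φ.source := mem_chart_source E 1
  have hsymm : ContMDiffAt 𝓘(ℝ, E) 𝓘(ℝ, E) ∞ φ.symm (φ 1) :=
    contMDiffOn_chart_symm.contMDiffAt (φ.open_target.mem_nhds (φ.map_source h1))
  have hchart : ContMDiffAt 𝓘(ℝ, E) 𝓘(ℝ, E) ∞ φ 1 :=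
    contMDiffOn_chart.contMDiffAt (φ.open_source.mem_nhds h1)
  have hm : ContMDiffAt 𝓘(ℝ, E) 𝓘(ℝ, E) ∞ (fun u : E => φ (𝔥.δ r (φ.symm u))) (φ 1) := by
    refine ContMDiffAt.comp (φ 1) (g := φ) (f := fun u : E => 𝔥.δ r (φ.symm u)) ?_
      (((𝔥.contMDiff_δ hr) _).comp (φ 1) hsymm)
    simpa [φ.left_inv h1, 𝔥.δ_apply_one hr] using hchart
  have hs := (contMDiffAt_iff_contDiffAt.1 hm).hasStrictFDerivAt (by simp)
  have hd : HasMFDerivAt 𝓘(ℝ, E) 𝓘(ℝ, E) (𝔥.δ r) 1 (mfderiv 𝓘(ℝ, E) 𝓘(ℝ, E) (𝔥.δ r) 1) :=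
    (((𝔥.contMDiff_δ hr) 1).mdifferentiableAt (by simp)).hasMFDerivAt
  have hd2 := hd.2
  -- stated for an arbitrary `L`, so that the type of `mfderiv`, which mentions `𝔥.δ r 1`, does not
  -- obstruct rewriting `𝔥.δ r 1` to `1`
  have hchange : ∀ L : E →L[ℝ] E,
      HasFDerivWithinAt (writtenInExtChartAt 𝓘(ℝ, E) 𝓘(ℝ, E) (1 : G) (𝔥.δ r)) L
        (Set.range 𝓘(ℝ, E)) (extChartAt 𝓘(ℝ, E) (1 : G) 1) →
      HasFDerivAt (fun u : E => φ (𝔥.δ r (φ.symm u))) L (φ 1) := by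
    intro L hL
    simp only [writtenInExtChartAt, 𝔥.δ_apply_one hr] at hL
    have hL' : HasFDerivAt (φ ∘ 𝔥.δ r ∘ φ.symm) L (φ 1) := by
      rw [← hasFDerivWithinAt_univ]
      simpa [← hφ] using hL
    exact hL'
  have hfd := hchange _ hd2
  have hD : (lieDilation G 𝔥.A r : E →L[ℝ] E) =
      (mfderiv 𝓘(ℝ, E) 𝓘(ℝ, E) (𝔥.δ r) 1 : E →L[ℝ] E) :=
    ContinuousLinearMap.ext fun X => (𝔥.mfderiv_one r hr X).symm
  rw [hD, ← hs.hasFDerivAt.unique hfd]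
  exact hs

variable [FiniteDimensional ℝ E] [SecondCountableTopology G] [MeasurableSpace G] [BorelSpace G]
  (μ : Measure G) [μ.IsHaarMeasure]

/-- Dilations scale Haar measure by the power of `r` given by the homogeneous dimension: in terms
of sets, `μ(r B) = r ^ Q μ(B)`. -/
theorem map_δ_haar {r : ℝ} (hr : 0 < r) :
    μ.map (𝔥.δ r) = ENNReal.ofReal (r ^ (-𝔥.Q)) • μ := by
  have : IsTopologicalGroup G := topologicalGroup_of_lieGroup 𝓘(ℝ, E) ∞
  have : LocallyCompactSpace G := Manifold.locallyCompact_of_finiteDimensional 𝓘(ℝ, E)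
  -- for every dilation the factor exists; it is bounded by the determinant of the differential
  have key : ∀ s : ℝ, 0 < s → ∃ c : ℝ≥0, μ.map (𝔥.δ s) = c • μ ∧ (c : ℝ) ≤ s ^ (-𝔥.Q) := by
    intro s hs
    let e : G ≃* G := { 𝔥.dilationHomeomorph hs with map_mul' := 𝔥.map_mul s hs }
    have : (μ.map (𝔥.δ s)).IsHaarMeasure :=
      MulEquiv.isHaarMeasure_map μ e (𝔥.dilationHomeomorph hs).continuous
        (𝔥.dilationHomeomorph hs).symm.continuous
    have hc := Measure.isMulLeftInvariant_eq_smul (μ.map (𝔥.δ s)) μ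
    refine ⟨_, hc, ?_⟩
    have hs' : 0 < s⁻¹ := inv_pos.2 hs
    have hb := haar_scaling_le_abs_det μ (chartAt E (1 : G)) (mem_chart_source E 1)
      LieGroup.hasStrictFDerivAt_mul_chart (𝔥.dilationHomeomorph hs') (𝔥.δ_apply_one hs') _
      (𝔥.hasStrictFDerivAt_δ_chart hs') ((μ.map (𝔥.δ s)).haarScalarFactor μ) fun B hB => by
        have h1 : 𝔥.dilationHomeomorph hs' '' B = 𝔥.δ s ⁻¹' B := by
          ext x
          constructor
          · rintro ⟨b, hb, rfl⟩
            simpa [dilationHomeomorph, 𝔥.δ_δ_inv hs] using hb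
          · intro hx
            exact ⟨_, hx, 𝔥.δ_inv_δ hs x⟩
        rw [h1, ← Measure.map_apply (𝔥.contMDiff_δ hs).continuous.measurable hB]
        conv_lhs => rw [hc]
        rfl
    have hb' := hb.trans_eq (𝔥.abs_det_lieDilation hs')
    rwa [Real.inv_rpow hs.le, ← Real.rpow_neg hs.le] at hb'
  obtain ⟨c, hc, hcle⟩ := key r hr
  obtain ⟨d, hd, hdle⟩ := key r⁻¹ (inv_pos.2 hr)
  have hmeas : ∀ {s : ℝ}, 0 < s → Measurable (𝔥.δ s) := fun hs =>
    (𝔥.contMDiff_δ hs).continuous.measurable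
  -- the factors of inverse dilations are inverse to each other, so both bounds are equalities
  have hcd : d * c = 1 := by
    have h1 : μ = (d * c) • μ := by
      calc μ = (μ.map (𝔥.δ r)).map (𝔥.δ r⁻¹) := by
            rw [Measure.map_map (hmeas (inv_pos.2 hr)) (hmeas hr)]
            have : 𝔥.δ r⁻¹ ∘ 𝔥.δ r = id := funext (𝔥.δ_inv_δ hr)
            rw [this, Measure.map_id]
        _ = (d * c) • μ := by rw [hc, Measure.map_smul, hd, smul_smul, mul_comm]
    obtain ⟨K, hK, hK1⟩ := exists_compact_mem_nhds (1 : G)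
    have h2 : μ K = (d * c : ℝ≥0) * μ K := by
      conv_lhs => rw [h1]
      rfl
    have h3 : μ K ≠ 0 := (μ.measure_pos_of_mem_nhds hK1).ne'
    have h4 : ((d * c : ℝ≥0) : ℝ≥0∞) * μ K = 1 * μ K := by rw [one_mul, ← h2]
    exact_mod_cast (ENNReal.mul_left_inj h3 hK.measure_lt_top.ne).1 h4
  have hpos : 0 < r ^ (-𝔥.Q) := Real.rpow_pos_of_pos hr _
  have hceq : (c : ℝ) = r ^ (-𝔥.Q) := by
    refine le_antisymm hcle ?_
    rw [Real.inv_rpow hr.le] at hdle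
    have hcd' : (d : ℝ) * c = 1 := by exact_mod_cast hcd
    have h5 : (1 : ℝ) ≤ (r ^ (-𝔥.Q))⁻¹ * c := by
      rw [← hcd']
      exact mul_le_mul_of_nonneg_right hdle c.2
    rwa [← div_eq_inv_mul, one_le_div hpos] at h5
  rw [hc, ← hceq, ENNReal.ofReal_coe_nnreal]
  rfl

theorem integral_comp_δ {F : Type*} [NormedAddCommGroup F] [NormedSpace ℝ F] {r : ℝ} (hr : 0 < r)
    (g : G → F) : ∫ x, g (𝔥.δ r x) ∂μ = r ^ (-𝔥.Q) • ∫ x, g x ∂μ := by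
  have h1 := ((𝔥.dilationHomeomorph hr).measurableEmbedding).integral_map (μ := μ) g
  have h2 : μ.map (𝔥.dilationHomeomorph hr) = ENNReal.ofReal (r ^ (-𝔥.Q)) • μ := 𝔥.map_δ_haar μ hr
  rw [h2, integral_smul_measure, ENNReal.toReal_ofReal (Real.rpow_nonneg hr.le _)] at h1
  exact h1.symm

end

end HomogeneousGroupStructure

/-! ### The Euler operator, integration by parts and the radial derivative -/

/-- The function `|x|^a u(x)`, whose value at the identity involves the value `0 ^ a`
of the real power; it is used only for `u` vanishing near the identity. -/
noncomputable def mulWeight {G : Type*} (N : G → ℝ) (a : ℝ) (u : G → ℂ) : G → ℂ :=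
  fun x => ((N x ^ a : ℝ) : ℂ) * u x

section

variable {E : Type*} [NormedAddCommGroup E] [NormedSpace ℝ E]
  {G : Type*} [Group G] [TopologicalSpace G] [ChartedSpace E G]

theorem IsTestFunctionOffIdentity.apply_one {u : G → ℂ}
    (hu : IsTestFunctionOffIdentity E u) : u 1 = 0 :=
  image_eq_zero_of_notMem_tsupport hu.2.2

theorem IsTestFunctionOffIdentity.add_const_mul {u v : G → ℂ}
    (hu : IsTestFunctionOffIdentity E u) (hv : IsTestFunctionOffIdentity E v) (c : ℂ) :
    IsTestFunctionOffIdentity E (fun x => u x + c * v x) := by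
  refine ⟨hu.1.add ((contDiff_const.mul contDiff_id).contMDiff.comp hv.1),
    hu.2.1.add hv.2.1.mul_left, fun h => ?_⟩
  rcases tsupport_add (f := u) (g := fun x => c * v x) h with h | h
  · exact hu.2.2 h
  · exact hv.2.2 (closure_mono (Function.support_mul_subset_right _ _) h)

end

namespace HomogeneousGroupStructure

section

variable {E : Type*} [NormedAddCommGroup E] [NormedSpace ℝ E]
  {G : Type*} [Group G] [TopologicalSpace G] [ChartedSpace E G]
  (𝔥 : HomogeneousGroupStructure E G)

/-- The Euler operator `u ↦ (x ↦ d/ds u(s x) |_{s = 1})`. -/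
noncomputable def eulerDeriv (u : G → ℂ) : G → ℂ := fun x => deriv (fun s : ℝ => u (𝔥.δ s x)) 1

theorem contMDiffAt_uncurry_δ {s : ℝ} (hs : 0 < s) (x : G) :
    ContMDiffAt (𝓘(ℝ, ℝ).prod 𝓘(ℝ, E)) 𝓘(ℝ, E) ∞ (fun q : ℝ × G => 𝔥.δ q.1 q.2) (s, x) :=
  𝔥.smooth.contMDiffAt ((isOpen_Ioi.prod isOpen_univ).mem_nhds ⟨hs, trivial⟩)

/-- The derivative of a smooth function along a dilation orbit, at any point of the orbit, is given
by the Euler operator. -/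
theorem hasDerivAt_comp_δ {u : G → ℂ} (hu : ContMDiff 𝓘(ℝ, E) 𝓘(ℝ, ℂ) ∞ u) {s : ℝ} (hs : 0 < s)
    (x : G) :
    HasDerivAt (fun s : ℝ => u (𝔥.δ s x)) ((s⁻¹ : ℝ) * 𝔥.eulerDeriv u (𝔥.δ s x)) s := by
  have hd : ∀ y : G, DifferentiableAt ℝ (fun s : ℝ => u (𝔥.δ s y)) 1 := by
    intro y
    have h1 : ContMDiffAt 𝓘(ℝ, ℝ) 𝓘(ℝ, ℂ) ∞ (fun s : ℝ => u (𝔥.δ s y)) 1 :=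
      (hu _).comp 1 ((𝔥.contMDiffAt_uncurry_δ one_pos y).comp 1
        (contMDiffAt_id.prodMk contMDiffAt_const))
    exact (contMDiffAt_iff_contDiffAt.1 h1).differentiableAt (by simp)
  have h2 : HasDerivAt (fun t : ℝ => u (𝔥.δ t (𝔥.δ s x))) (𝔥.eulerDeriv u (𝔥.δ s x)) (s / s) := by
    rw [div_self hs.ne']
    exact (hd _).hasDerivAt
  have h3 := HasDerivAt.scomp (h := fun t : ℝ => id t / s) s h2 ((hasDerivAt_id s).div_const s)
  refine HasDerivAt.congr_of_eventuallyEq (by simpa using h3) ?_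
  filter_upwards [lt_mem_nhds hs] with t ht
  simp [← 𝔥.δ_mul _ _ (div_pos ht hs) hs, div_mul_cancel₀ _ hs.ne']

/-- Unlike the radial derivative, which involves the merely continuous quasi-norm, the Euler
operator preserves `C₀^∞(G ∖ {1})`. -/
theorem isTestFunctionOffIdentity_eulerDeriv [LieGroup 𝓘(ℝ, E) ∞ G] {u : G → ℂ}
    (hu : IsTestFunctionOffIdentity E u) : IsTestFunctionOffIdentity E (𝔥.eulerDeriv u) := by
  have : IsManifold 𝓘(ℝ, E) 1 G := IsManifold.of_le (n := ∞) (by simp)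
  have hsupp : tsupport (𝔥.eulerDeriv u) ⊆ tsupport u := by
    refine closure_minimal (fun x hx => ?_) (isClosed_tsupport u)
    by_contra hx'
    refine hx ?_
    have h0 : u =ᶠ[𝓝 x] 0 := notMem_tsupport_iff_eventuallyEq.1 hx'
    have hc : ContinuousAt (fun s : ℝ => 𝔥.δ s x) 1 :=
      ((𝔥.contMDiffAt_uncurry_δ one_pos x).comp 1
        (contMDiffAt_id.prodMk contMDiffAt_const)).continuousAt
    have h1 : (fun s : ℝ => u (𝔥.δ s x)) =ᶠ[𝓝 1] fun _ => 0 := by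
      have hc' : Tendsto (fun s : ℝ => 𝔥.δ s x) (𝓝 1) (𝓝 x) := by
        simpa [ContinuousAt, 𝔥.δ_one] using hc
      exact hc'.eventually h0
    rw [eulerDeriv, h1.deriv_eq, deriv_const]
  refine ⟨fun x => ?_, hu.2.1.of_isClosed_subset (isClosed_tsupport _) hsupp,
    fun h => hu.2.2 (hsupp h)⟩
  have h1 : ContMDiffAt (𝓘(ℝ, E).prod 𝓘(ℝ, ℝ)) 𝓘(ℝ, ℂ) ∞
      (Function.uncurry fun (x : G) (s : ℝ) => u (𝔥.δ s x)) (x, 1) :=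
    (hu.1 _).comp (x, (1 : ℝ)) ((𝔥.contMDiffAt_uncurry_δ one_pos x).comp (x, (1 : ℝ))
      (contMDiffAt_snd.prodMk contMDiffAt_fst))
  have h2 := ContMDiffAt.mfderiv (m := ∞) (fun (x : G) (s : ℝ) => u (𝔥.δ s x)) (fun _ => (1 : ℝ)) h1
    contMDiffAt_const (by simp)
  have h2' : ContMDiffAt 𝓘(ℝ, E) 𝓘(ℝ, ℝ →L[ℝ] ℂ) ∞
      (fun y => fderiv ℝ (fun s : ℝ => u (𝔥.δ s y)) 1) x := by
    have e := inTangentCoordinates_model_space (I := 𝓘(ℝ, ℝ)) (I' := 𝓘(ℝ, ℂ)) (fun _ : G => (1 : ℝ))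
      (fun y => u (𝔥.δ 1 y)) (fun y => fderiv ℝ (fun s : ℝ => u (𝔥.δ s y)) 1) x
    rw [← e]
    simpa only [mfderiv_eq_fderiv] using h2
  have h3 := h2'.clm_apply (contMDiffAt_const (c := (1 : ℝ)))
  refine h3.congr_of_eventuallyEq (Eventually.of_forall fun y => ?_)
  simp [eulerDeriv]

end

section weights

variable {E : Type*} [NormedAddCommGroup E] [NormedSpace ℝ E]
  {G : Type*} [Group G] [TopologicalSpace G] [ChartedSpace E G]
  {𝔥 : HomogeneousGroupStructure E G} {N : G → ℝ}

theorem IsQuasiNorm.pos (hN : 𝔥.IsQuasiNorm N) {x : G} (hx : x ≠ 1) : 0 < N x :=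
  (hN.nonneg x).lt_of_ne fun h => hx ((hN.eq_zero_iff x).1 h.symm)

theorem IsQuasiNorm.divWeight_mulWeight (hN : 𝔥.IsQuasiNorm N) {u : G → ℂ}
    (hu : IsTestFunctionOffIdentity E u) (a s : ℝ) :
    divWeight N s (mulWeight N a u) = mulWeight N (a - s) u := by
  funext x
  by_cases hx : x = 1
  · simp [divWeight, mulWeight, hx, hu.apply_one]
  · simp only [divWeight, mulWeight]
    rw [Real.rpow_sub (hN.pos hx)]
    push_cast
    ring

theorem hasCompactSupport_mulWeight {u : G → ℂ}
    (hu : IsTestFunctionOffIdentity E u) (a : ℝ) : HasCompactSupport (mulWeight N a u) :=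
  hu.2.1.mul_left

theorem IsQuasiNorm.continuous_mulWeight (hN : 𝔥.IsQuasiNorm N) {u : G → ℂ}
    (hu : IsTestFunctionOffIdentity E u) (a : ℝ) : Continuous (mulWeight N a u) := by
  refine continuous_of_tsupport fun x hx => ?_
  have hx1 : x ≠ 1 := by
    rintro rfl
    exact hu.2.2 (closure_mono (Function.support_mul_subset_right _ _) hx)
  have h1 : ContinuousAt (fun y => N y ^ a) x :=
    hN.continuous.continuousAt.rpow_const (Or.inl (hN.pos hx1).ne')
  exact (Complex.continuous_ofReal.continuousAt.comp h1).mul hu.1.continuous.continuousAt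

theorem IsQuasiNorm.hasDerivAt_mulWeight_comp_δ (hN : 𝔥.IsQuasiNorm N) {u : G → ℂ}
    (hu : IsTestFunctionOffIdentity E u) (a : ℝ) {s : ℝ} (hs : 0 < s) (x : G) :
    HasDerivAt (fun s : ℝ => mulWeight N a u (𝔥.δ s x))
      ((s⁻¹ : ℝ) * mulWeight N a (fun y => 𝔥.eulerDeriv u y + a * u y) (𝔥.δ s x)) s := by
  have h1 : HasDerivAt (fun s : ℝ => ((s ^ a : ℝ) : ℂ)) ((a * s ^ (a - 1) : ℝ) : ℂ) s :=
    (Real.hasDerivAt_rpow_const (Or.inl hs.ne')).ofReal_comp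
  have h2 := (h1.mul (𝔥.hasDerivAt_comp_δ hu.1 hs x)).const_mul ((N x ^ a : ℝ) : ℂ)
  refine HasDerivAt.congr_of_eventuallyEq (h2.congr_deriv ?_) ?_
  · simp only [mulWeight, hN.homogeneous s hs, Real.mul_rpow hs.le (hN.nonneg x),
      Real.rpow_sub_one hs.ne']
    push_cast
    ring
  · filter_upwards [lt_mem_nhds hs] with t ht
    simp only [mulWeight, hN.homogeneous t ht, Real.mul_rpow ht.le (hN.nonneg x), Pi.mul_apply]
    push_cast
    ring

/-- `𝓡 (|x|^a u) = |x|^(a - 1) (𝔼 u + a u)`, where `𝔼` is the Euler operator. Both sides vanish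
at the identity: there `N x = 0` and the function differentiated is constant, since `r / 0 = 0`. -/
theorem IsQuasiNorm.radialDeriv_mulWeight [LieGroup 𝓘(ℝ, E) ∞ G] (hN : 𝔥.IsQuasiNorm N) {u : G → ℂ}
    (hu : IsTestFunctionOffIdentity E u) (a : ℝ) :
    𝔥.radialDeriv N (mulWeight N a u) =
      mulWeight N (a - 1) (fun y => 𝔥.eulerDeriv u y + a * u y) := by
  funext x
  by_cases hx : x = 1
  · subst hx
    have h0 : N 1 = 0 := (hN.eq_zero_iff 1).2 rfl
    simp [radialDeriv, mulWeight, h0, hu.apply_one,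
      (𝔥.isTestFunctionOffIdentity_eulerDeriv hu).apply_one]
  · have hpos := hN.pos hx
    have h1 := hN.hasDerivAt_mulWeight_comp_δ hu a one_pos x
    rw [← div_self hpos.ne'] at h1
    have h2 := HasDerivAt.scomp (h := fun t : ℝ => id t / N x) (N x) h1
      ((hasDerivAt_id (N x)).div_const (N x))
    rw [radialDeriv]
    refine h2.deriv.trans ?_
    simp only [mulWeight, div_self hpos.ne', 𝔥.δ_one, Real.rpow_sub_one hpos.ne',
      Complex.real_smul]
    push_cast
    ring

/-- The functions `|x|^a u` with `u` a test function form a class stable under the radial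
derivative, which is why it can be iterated. -/
theorem IsQuasiNorm.exists_radialDeriv_iterate_eq [LieGroup 𝓘(ℝ, E) ∞ G]
    (hN : 𝔥.IsQuasiNorm N) {u : G → ℂ} (hu : IsTestFunctionOffIdentity E u) (a : ℝ) (j : ℕ) :
    ∃ v : G → ℂ, IsTestFunctionOffIdentity E v ∧
      (𝔥.radialDeriv N)^[j] (mulWeight N a u) = mulWeight N (a - j) v := by
  induction j with
  | zero => exact ⟨u, hu, by simp⟩
  | succ j ih =>
    obtain ⟨v, hv, h⟩ := ih
    refine ⟨_, (𝔥.isTestFunctionOffIdentity_eulerDeriv hv).add_const_mul hv (a - j : ℝ), ?_⟩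
    rw [Function.iterate_succ_apply', h, hN.radialDeriv_mulWeight hv]
    push_cast
    rw [sub_sub]

theorem IsQuasiNorm.memLp_divWeight_radialDeriv_iterate [LieGroup 𝓘(ℝ, E) ∞ G] [MeasurableSpace G]
    [BorelSpace G] (μ : Measure G) [IsFiniteMeasureOnCompacts μ] (hN : 𝔥.IsQuasiNorm N)
    (p : ℝ≥0∞) {u : G → ℂ} (hu : IsTestFunctionOffIdentity E u) (a s : ℝ) (j : ℕ) :
    MemLp (divWeight N s ((𝔥.radialDeriv N)^[j] (mulWeight N a u))) p μ := by
  obtain ⟨v, hv, h⟩ := hN.exists_radialDeriv_iterate_eq hu a j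
  rw [h, hN.divWeight_mulWeight hv]
  exact (hN.continuous_mulWeight hv _).memLp_of_hasCompactSupport
    (hasCompactSupport_mulWeight hv _)

end weights

section euler

variable {E : Type*} [NormedAddCommGroup E] [NormedSpace ℝ E] [FiniteDimensional ℝ E]
  {G : Type*} [Group G] [TopologicalSpace G] [ChartedSpace E G] [LieGroup 𝓘(ℝ, E) ∞ G]
  [T2Space G] [SecondCountableTopology G] [MeasurableSpace G] [BorelSpace G]
  (μ : Measure G) [μ.IsHaarMeasure] (𝔥 : HomogeneousGroupStructure E G)

/-- The Euler operator integrates by parts like `∫ 𝔼 φ = -Q ∫ φ`: differentiate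
`∫ φ(s x) dx = s ^ (-Q) ∫ φ(x) dx` at `s = 1`. -/
theorem integral_euler_eq {φ ψ : G → ℝ} (hφ : Continuous φ) (hφc : HasCompactSupport φ)
    (hψ : Continuous ψ) (hψc : HasCompactSupport ψ)
    (hd : ∀ x, ∀ s : ℝ, 0 < s → HasDerivAt (fun s : ℝ => φ (𝔥.δ s x)) (s⁻¹ * ψ (𝔥.δ s x)) s) :
    ∫ x, ψ x ∂μ = -𝔥.Q * ∫ x, φ x ∂μ := by
  have hcont : ∀ {s : ℝ}, 0 < s → Continuous (𝔥.δ s) := fun hs => (𝔥.contMDiff_δ hs).continuous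
  obtain ⟨C, hC⟩ := hψc.exists_bound_of_continuous hψ
  -- `K` contains every `x` with `s x` in the support of `ψ` for some `s ∈ [1/2, 2]`
  set K : Set G := (fun q : ℝ × G => 𝔥.δ q.1⁻¹ q.2) '' (Set.Icc (1 / 2) 2 ×ˢ tsupport ψ) with hK
  have hKc : IsCompact K := by
    refine (isCompact_Icc.prod hψc).image_of_continuousOn fun q hq => ?_
    have hq1 : (0 : ℝ) < q.1 := lt_of_lt_of_le (by norm_num) hq.1.1
    have h1 : ContinuousAt (fun q : ℝ × G => 𝔥.δ q.1 q.2) (q.1⁻¹, q.2) :=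
      (𝔥.contMDiffAt_uncurry_δ (inv_pos.2 hq1) q.2).continuousAt
    have h2 : ContinuousAt (fun q : ℝ × G => (q.1⁻¹, q.2)) q :=
      (continuousAt_fst.inv₀ hq1.ne').prodMk continuousAt_snd
    exact (ContinuousAt.comp (f := fun q : ℝ × G => (q.1⁻¹, q.2))
      (g := fun q : ℝ × G => 𝔥.δ q.1 q.2) h1 h2).continuousWithinAt
  have hnear : Set.Ioo (1 / 2 : ℝ) 2 ∈ 𝓝 (1 : ℝ) := Ioo_mem_nhds (by norm_num) (by norm_num)
  have hint := hasDerivAt_integral_of_dominated_loc_of_deriv_le (μ := μ)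
    (F := fun s x => φ (𝔥.δ s x)) (F' := fun s x => s⁻¹ * ψ (𝔥.δ s x)) (x₀ := (1 : ℝ))
    (bound := K.indicator fun _ => 2 * C) hnear ?_ ?_ ?_ ?_ ?_ ?_
  · have h1 := hint.2
    have h2 : HasDerivAt (fun s : ℝ => ∫ x, φ (𝔥.δ s x) ∂μ) (-𝔥.Q * ∫ x, φ x ∂μ) 1 := by
      have h3 : HasDerivAt (fun s : ℝ => s ^ (-𝔥.Q) * ∫ x, φ x ∂μ)
          ((-𝔥.Q * 1 ^ (-𝔥.Q - 1)) * ∫ x, φ x ∂μ) 1 :=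
        (Real.hasDerivAt_rpow_const (Or.inl one_ne_zero)).mul_const _
      rw [Real.one_rpow, mul_one] at h3
      refine h3.congr_of_eventuallyEq ?_
      filter_upwards [lt_mem_nhds (zero_lt_one' ℝ)] with s hs
      exact 𝔥.integral_comp_δ μ hs φ
    simpa [𝔥.δ_one] using h1.unique h2
  · filter_upwards [lt_mem_nhds (zero_lt_one' ℝ)] with s hs
    exact (hφ.comp (hcont hs)).aestronglyMeasurable
  · simpa [𝔥.δ_one] using hφ.integrable_of_hasCompactSupport hφc
  · simpa [𝔥.δ_one] using hψ.aestronglyMeasurable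
  · refine Eventually.of_forall fun x s hs => ?_
    have hs0 : (0 : ℝ) < s := lt_trans (by norm_num) hs.1
    by_cases hx : 𝔥.δ s x ∈ tsupport ψ
    · have hxK : x ∈ K := ⟨(s, 𝔥.δ s x), ⟨⟨hs.1.le, hs.2.le⟩, hx⟩, 𝔥.δ_inv_δ hs0 x⟩
      rw [Set.indicator_of_mem hxK, norm_mul]
      have hs2 : ‖s⁻¹‖ ≤ 2 := by
        rw [Real.norm_of_nonneg (inv_pos.2 hs0).le, inv_le_comm₀ hs0 two_pos]
        linarith [hs.1]
      exact mul_le_mul hs2 (hC _) (norm_nonneg _) two_pos.le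
    · rw [image_eq_zero_of_notMem_tsupport hx, mul_zero, norm_zero]
      exact Set.indicator_nonneg (fun _ _ => by linarith [(norm_nonneg _).trans (hC 1)]) x
  · exact (integrableOn_const hKc.measure_lt_top.ne).integrable_indicator hKc.measurableSet
  · refine Eventually.of_forall fun x s hs => hd x s (lt_trans (by norm_num) hs.1)

end euler

end HomogeneousGroupStructure

/-! ### `L^p` norms of continuous functions with compact support -/

theorem realLpNorm_nonneg {X : Type*} [MeasurableSpace X] (p : ℝ) (μ : Measure X) (g : X → ℂ) :
    0 ≤ realLpNorm p μ g :=
  ENNReal.toReal_nonneg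

section lpNorm

variable {X : Type*} [TopologicalSpace X] [MeasurableSpace X] [OpensMeasurableSpace X]
  {μ : Measure X} [IsFiniteMeasureOnCompacts μ]

theorem realLpNorm_eq_integral_rpow {p : ℝ} (hp : 1 < p) {g : X → ℂ} (hg : Continuous g)
    (hgc : HasCompactSupport g) : realLpNorm p μ g = (∫ x, ‖g x‖ ^ p ∂μ) ^ (1 / p) := by
  have h0 : 0 < p := one_pos.trans hp
  have hmem : MemLp g (ENNReal.ofReal p) μ := hg.memLp_of_hasCompactSupport hgc
  rw [realLpNorm, hmem.eLpNorm_eq_integral_rpow_norm (by simpa using h0) ENNReal.ofReal_ne_top,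
    ENNReal.toReal_ofReal h0.le, ENNReal.toReal_ofReal (by positivity), one_div]

theorem realLpNorm_rpow_eq_integral {p : ℝ} (hp : 1 < p) {g : X → ℂ} (hg : Continuous g)
    (hgc : HasCompactSupport g) : realLpNorm p μ g ^ p = ∫ x, ‖g x‖ ^ p ∂μ := by
  rw [realLpNorm_eq_integral_rpow hp hg hgc, ← Real.rpow_mul (by positivity),
    one_div_mul_cancel (one_pos.trans hp).ne', Real.rpow_one]

theorem integral_norm_mul_norm_rpow_sub_one_le {p : ℝ} (hp : 1 < p) {g h : X → ℂ}
    (hg : Continuous g) (hgc : HasCompactSupport g) (hh : Continuous h)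
    (hhc : HasCompactSupport h) :
    ∫ x, ‖g x‖ * ‖h x‖ ^ (p - 1) ∂μ ≤ realLpNorm p μ g * realLpNorm p μ h ^ (p - 1) := by
  have hp0 : 0 < p := one_pos.trans hp
  have hp1 : 0 < p - 1 := sub_pos.2 hp
  have hcont : Continuous fun x => ‖h x‖ ^ (p - 1) :=
    hh.norm.rpow_const fun _ => Or.inr hp1.le
  have hcomp : HasCompactSupport fun x => ‖h x‖ ^ (p - 1) :=
    hhc.comp_left (g := fun z : ℂ => ‖z‖ ^ (p - 1)) (by simp [hp1.ne'])
  have hpq := Real.HolderConjugate.conjExponent hp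
  have key := integral_mul_le_Lp_mul_Lq_of_nonneg (μ := μ) hpq
    (Eventually.of_forall fun x => norm_nonneg (g x))
    (Eventually.of_forall fun x => Real.rpow_nonneg (norm_nonneg (h x)) (p - 1))
    (hg.norm.memLp_of_hasCompactSupport hgc.norm) (hcont.memLp_of_hasCompactSupport hcomp)
  refine key.trans_eq ?_
  have e : ∀ x, (‖h x‖ ^ (p - 1)) ^ p.conjExponent = ‖h x‖ ^ p := by
    intro x
    rw [← Real.rpow_mul (norm_nonneg _), Real.conjExponent, mul_div_cancel₀ _ hp1.ne']
  simp only [e]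
  rw [realLpNorm_eq_integral_rpow hp hg hgc, realLpNorm_eq_integral_rpow hp hh hhc,
    ← Real.rpow_mul (by positivity)]
  congr 2
  rw [Real.conjExponent]
  field_simp

end lpNorm

/-! ### Weighted inequalities for the radial derivative -/

namespace HomogeneousGroupStructure

variable {E : Type*} [NormedAddCommGroup E] [NormedSpace ℝ E] [FiniteDimensional ℝ E]
  {G : Type*} [Group G] [TopologicalSpace G] [ChartedSpace E G] [LieGroup 𝓘(ℝ, E) ∞ G]
  [T2Space G] [SecondCountableTopology G] [MeasurableSpace G] [BorelSpace G]
  (μ : Measure G) [μ.IsHaarMeasure] {𝔥 : HomogeneousGroupStructure E G} {N : G → ℝ}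

/-- `∫ 𝔼 (|g|^p) = -Q ∫ |g|^p` for `g = |x|^b u`, with the left side expanded by the chain rule
through the `C¹` function `z ↦ |z|^p`, `p > 1`. -/
theorem IsQuasiNorm.integral_fderiv_norm_rpow_eq (hN : 𝔥.IsQuasiNorm N) {p : ℝ} (hp : 1 < p)
    {u : G → ℂ} (hu : IsTestFunctionOffIdentity E u) (b : ℝ) :
    ∫ x, fderiv ℝ (fun z : ℂ => ‖z‖ ^ p) (mulWeight N b u x)
        (mulWeight N b (fun y => 𝔥.eulerDeriv u y + b * u y) x) ∂μ =
      -𝔥.Q * ∫ x, ‖mulWeight N b u x‖ ^ p ∂μ := by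
  have hv := (𝔥.isTestFunctionOffIdentity_eulerDeriv hu).add_const_mul hu b
  have hc := hN.continuous_mulWeight hu b
  have hvc := hN.continuous_mulWeight hv b
  have hC1 : ContDiff ℝ 1 fun z : ℂ => ‖z‖ ^ p := contDiff_norm_rpow hp
  refine 𝔥.integral_euler_eq μ ?_ ?_ ?_ ?_ fun x s hs => ?_
  · exact hC1.continuous.comp hc
  · exact (hasCompactSupport_mulWeight hu b).comp_left (g := fun z : ℂ => ‖z‖ ^ p)
      (by simp [(one_pos.trans hp).ne'])
  · exact ((hC1.continuous_fderiv (by simp)).comp hc).clm_apply hvc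
  · refine (hasCompactSupport_mulWeight (N := N) hv b).mono fun x hx hx' => hx ?_
    simp only [hx', map_zero]
  · have h1 := (hC1.differentiable (by simp) (mulWeight N b u (𝔥.δ s x))).hasFDerivAt
    have h2 := h1.comp_hasDerivAt s (hN.hasDerivAt_mulWeight_comp_δ hu b hs x)
    refine h2.congr_deriv ?_
    rw [← Complex.real_smul, map_smul, smul_eq_mul]

/-- The first-order inequality, that is, the case `m = k = 0`. -/
theorem IsQuasiNorm.caffarelliKohnNirenberg (hN : 𝔥.IsQuasiNorm N) {p : ℝ} (hp : 1 < p)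
    {u : G → ℂ} (hu : IsTestFunctionOffIdentity E u) (a α β γ : ℝ) (hγ : γ = α + β + 1) :
    |𝔥.Q - γ| / p * realLpNorm p μ (divWeight N (γ / p) (mulWeight N a u)) ^ p ≤
      realLpNorm p μ (divWeight N α (𝔥.radialDeriv N (mulWeight N a u))) *
        realLpNorm p μ (divWeight N (β / (p - 1)) (mulWeight N a u)) ^ (p - 1) := by
  have hp0 : 0 < p := one_pos.trans hp
  have hp1 : 0 < p - 1 := sub_pos.2 hp
  have hv := (𝔥.isTestFunctionOffIdentity_eulerDeriv hu).add_const_mul hu a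
  rw [hN.radialDeriv_mulWeight hu, hN.divWeight_mulWeight hu, hN.divWeight_mulWeight hu,
    hN.divWeight_mulWeight hv]
  set b := a - γ / p with hb
  set v : G → ℂ := fun y => 𝔥.eulerDeriv u y + a * u y with hvdef
  set L : ℂ → ℂ →L[ℝ] ℝ := fun z => fderiv ℝ (fun z : ℂ => ‖z‖ ^ p) z with hL
  have hC1 : ContDiff ℝ 1 fun z : ℂ => ‖z‖ ^ p := contDiff_norm_rpow hp
  have hcb := hN.continuous_mulWeight hu b
  have hcv := hN.continuous_mulWeight hv b
  have hsb := hasCompactSupport_mulWeight (N := N) hu b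
  have hsv := hasCompactSupport_mulWeight (N := N) hv b
  have hLself : ∀ z : ℂ, L z z = p * ‖z‖ ^ p := by
    intro z
    by_cases hz : z = 0
    · simp [hz, hp0.ne']
    · have hz' : 0 < ‖z‖ := norm_pos_iff.2 hz
      simp only [hL]
      rw [fderiv_norm_rpow z hp]
      simp only [smul_apply, innerSL_apply_apply, real_inner_self_eq_norm_sq,
        smul_eq_mul, Real.rpow_sub hz', Real.rpow_two]
      field_simp
  have hLle : ∀ z w : ℂ, |L z w| ≤ p * (‖z‖ ^ (p - 1) * ‖w‖) := by
    intro z w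
    have := (L z).le_opNorm w
    simp only [hL] at this
    rw [norm_fderiv_norm_id_rpow z hp, Real.norm_eq_abs] at this
    linarith
  have hint : Integrable (fun x => ‖mulWeight N b u x‖ ^ p) μ :=
    (hC1.continuous.comp hcb).integrable_of_hasCompactSupport
      (hsb.comp_left (g := fun z : ℂ => ‖z‖ ^ p) (by simp [hp0.ne']))
  have hLc : Continuous fun x => L (mulWeight N b u x) (mulWeight N b v x) :=
    ((hC1.continuous_fderiv (by simp)).comp hcb).clm_apply hcv
  have hLi : Integrable (fun x => L (mulWeight N b u x) (mulWeight N b v x)) μ := by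
    refine hLc.integrable_of_hasCompactSupport (hsv.mono fun x hx hx' => hx ?_)
    simp only [hx', map_zero]
  -- the weight turns `-Q` into `γ - Q`, because `𝔼 u + b u = v - (γ / p) u`
  have hid : (γ - 𝔥.Q) * ∫ x, ‖mulWeight N b u x‖ ^ p ∂μ =
      ∫ x, L (mulWeight N b u x) (mulWeight N b v x) ∂μ := by
    have h1 := hN.integral_fderiv_norm_rpow_eq μ hp hu b
    have h2 : ∀ x, fderiv ℝ (fun z : ℂ => ‖z‖ ^ p) (mulWeight N b u x)
        (mulWeight N b (fun y => 𝔥.eulerDeriv u y + b * u y) x) =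
        L (mulWeight N b u x) (mulWeight N b v x) - γ * ‖mulWeight N b u x‖ ^ p := by
      intro x
      have h3 : mulWeight N b (fun y => 𝔥.eulerDeriv u y + b * u y) x =
          mulWeight N b v x - (γ / p) • mulWeight N b u x := by
        simp only [mulWeight, hvdef, hb, Complex.real_smul]
        push_cast
        ring
      rw [h3, map_sub, map_smul]
      change _ - (γ / p) • L _ _ = _
      rw [hLself, smul_eq_mul, ← mul_assoc, div_mul_cancel₀ _ hp0.ne']
    simp only [h2] at h1
    rw [integral_sub hLi (hint.const_mul _), integral_const_mul] at h1
    linarith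
  set A := mulWeight N (a - 1 - α) v with hA
  set B := mulWeight N (a - β / (p - 1)) u with hB
  have hcA : Continuous A := hN.continuous_mulWeight hv _
  have hcB : Continuous B := hN.continuous_mulWeight hu _
  have hsA : HasCompactSupport A := hasCompactSupport_mulWeight hv _
  have hsB : HasCompactSupport B := hasCompactSupport_mulWeight hu _
  have hpt : ∀ x, |L (mulWeight N b u x) (mulWeight N b v x)| ≤ p * (‖A x‖ * ‖B x‖ ^ (p - 1)) := by
    intro x
    refine (hLle _ _).trans_eq ?_
    by_cases hx : x = 1
    · simp [hA, mulWeight, hx, hv.apply_one]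
    · have hpos := hN.pos hx
      have hn : ∀ c : ℝ, ‖((N x ^ c : ℝ) : ℂ)‖ = N x ^ c := fun c => by
        rw [Complex.norm_real, Real.norm_of_nonneg (Real.rpow_nonneg hpos.le _)]
      simp only [hA, hB, mulWeight, norm_mul, hn]
      rw [Real.mul_rpow (Real.rpow_nonneg hpos.le _) (norm_nonneg _),
        Real.mul_rpow (Real.rpow_nonneg hpos.le _) (norm_nonneg _), ← Real.rpow_mul hpos.le,
        ← Real.rpow_mul hpos.le]
      have he : N x ^ (b * (p - 1)) * N x ^ b =
          N x ^ (a - 1 - α) * N x ^ ((a - β / (p - 1)) * (p - 1)) := by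
        rw [← Real.rpow_add hpos, ← Real.rpow_add hpos, hb, hγ]
        congr 1
        field_simp
        ring
      linear_combination p * (‖u x‖ ^ (p - 1) * ‖v x‖) * he
  have hABi : Integrable (fun x => ‖A x‖ * ‖B x‖ ^ (p - 1)) μ := by
    refine (hcA.norm.mul (hcB.norm.rpow_const
      fun _ => Or.inr hp1.le)).integrable_of_hasCompactSupport hsA.norm.mul_right
  rw [realLpNorm_rpow_eq_integral hp hcb hsb]
  have hI0 : 0 ≤ ∫ x, ‖mulWeight N b u x‖ ^ p ∂μ := integral_nonneg fun x => by positivity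
  have hfin : |𝔥.Q - γ| * ∫ x, ‖mulWeight N b u x‖ ^ p ∂μ ≤
      p * (realLpNorm p μ A * realLpNorm p μ B ^ (p - 1)) := by
    calc |𝔥.Q - γ| * ∫ x, ‖mulWeight N b u x‖ ^ p ∂μ
        = |∫ x, L (mulWeight N b u x) (mulWeight N b v x) ∂μ| := by
          rw [← hid, abs_mul, abs_of_nonneg hI0, abs_sub_comm]
      _ ≤ ∫ x, |L (mulWeight N b u x) (mulWeight N b v x)| ∂μ := abs_integral_le_integral_abs
      _ ≤ ∫ x, p * (‖A x‖ * ‖B x‖ ^ (p - 1)) ∂μ :=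
          integral_mono hLi.abs (hABi.const_mul p) hpt
      _ = p * ∫ x, ‖A x‖ * ‖B x‖ ^ (p - 1) ∂μ := integral_const_mul _ _
      _ ≤ _ := mul_le_mul_of_nonneg_left
          (integral_norm_mul_norm_rpow_sub_one_le hp hcA hsA hcB hsB) hp0.le
  rw [div_mul_eq_mul_div, div_le_iff₀ hp0]
  linarith

/-- The weighted Hardy inequality, the special case of the first-order inequality in which the
function on the left side reappears on the right and can be cancelled. -/
theorem IsQuasiNorm.hardy (hN : 𝔥.IsQuasiNorm N) {p : ℝ} (hp : 1 < p)
    {u : G → ℂ} (hu : IsTestFunctionOffIdentity E u) (a α : ℝ) :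
    |𝔥.Q - p * α| * realLpNorm p μ (divWeight N α (mulWeight N a u)) ≤
      p * realLpNorm p μ (divWeight N (α - 1) (𝔥.radialDeriv N (mulWeight N a u))) := by
  have hp0 : 0 < p := one_pos.trans hp
  have hp1 : 0 < p - 1 := sub_pos.2 hp
  -- with these exponents both weights that multiply the undifferentiated function equal `|x|^α`
  have h := hN.caffarelliKohnNirenberg μ hp hu a (α - 1) (α * (p - 1)) (p * α) (by ring)
  rw [mul_div_cancel_left₀ _ hp0.ne', mul_div_cancel_right₀ _ hp1.ne'] at h
  rcases (realLpNorm_nonneg p μ (divWeight N α (mulWeight N a u))).eq_or_lt with h0 | h0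
  · rw [← h0, mul_zero]
    exact mul_nonneg hp0.le (realLpNorm_nonneg p μ _)
  · have hY : 0 < realLpNorm p μ (divWeight N α (mulWeight N a u)) ^ (p - 1) :=
      Real.rpow_pos_of_pos h0 _
    have hX := Real.rpow_sub_one h0.ne' p
    rw [eq_div_iff h0.ne'] at hX
    rw [← hX] at h
    have h' : |𝔥.Q - p * α| / p * realLpNorm p μ (divWeight N α (mulWeight N a u)) ≤
        realLpNorm p μ (divWeight N (α - 1) (𝔥.radialDeriv N (mulWeight N a u))) :=
      le_of_mul_le_mul_right (by linarith) hY
    rw [div_mul_eq_mul_div, div_le_iff₀ hp0] at h'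
    linarith

theorem IsQuasiNorm.hardy_iterate (hN : 𝔥.IsQuasiNorm N) {p : ℝ} (hp : 1 < p)
    {u : G → ℂ} (hu : IsTestFunctionOffIdentity E u) (a α : ℝ) (m : ℕ) :
    (∏ j ∈ Finset.range m, |𝔥.Q - p * (α - j)|) *
        realLpNorm p μ (divWeight N α (mulWeight N a u)) ≤
      p ^ m * realLpNorm p μ (divWeight N (α - m) ((𝔥.radialDeriv N)^[m] (mulWeight N a u))) := by
  induction m with
  | zero => simp
  | succ m ih =>
    obtain ⟨v, hv, h⟩ := hN.exists_radialDeriv_iterate_eq hu a m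
    have h1 := hN.hardy μ hp hv (a - m) (α - m)
    rw [Finset.prod_range_succ, Function.iterate_succ_apply']
    rw [h] at ih ⊢
    have e : α - ((m + 1 : ℕ) : ℝ) = α - m - 1 := by push_cast; ring
    rw [e]
    have hp0 : 0 ≤ p := (one_pos.trans hp).le
    calc _ = |𝔥.Q - p * (α - m)| * ((∏ j ∈ Finset.range m, |𝔥.Q - p * (α - j)|) *
          realLpNorm p μ (divWeight N α (mulWeight N a u))) := by ring
      _ ≤ |𝔥.Q - p * (α - m)| * (p ^ m *
          realLpNorm p μ (divWeight N (α - m) (mulWeight N (a - m) v))) :=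
        mul_le_mul_of_nonneg_left ih (abs_nonneg _)
      _ = p ^ m * (|𝔥.Q - p * (α - m)| *
          realLpNorm p μ (divWeight N (α - m) (mulWeight N (a - m) v))) := by ring
      _ ≤ p ^ m * (p * realLpNorm p μ (divWeight N (α - m - 1)
          (𝔥.radialDeriv N (mulWeight N (a - m) v)))) :=
        mul_le_mul_of_nonneg_left h1 (pow_nonneg hp0 m)
      _ = _ := by ring

end HomogeneousGroupStructure

end

theorem proposition4p1
    {E : Type*} [NormedAddCommGroup E] [NormedSpace ℝ E] [FiniteDimensional ℝ E]
    {G : Type*} [Group G] [TopologicalSpace G] [T2Space G] [SecondCountableTopology G]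
    [ChartedSpace E G] [LieGroup 𝓘(ℝ, E) ∞ G] [SimplyConnectedSpace G]
    [MeasurableSpace G] [BorelSpace G] (μ : Measure G) [μ.IsHaarMeasure]
    (𝔥 : HomogeneousGroupStructure E G)
    (N : G → ℝ) (hN : 𝔥.IsQuasiNorm N)
    (p : ℝ) (hp : 1 < p) (k m : ℕ) (α β γ : ℝ) (hγ : γ = α + β + 1)
    (hα : ∏ j ∈ Finset.range m, |𝔥.Q - p * (α - j)| ≠ 0)
    (hβ : ∏ j ∈ Finset.range k, |𝔥.Q - p * (β / (p - 1) - j)| ≠ 0)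
    (f : G → ℂ) (hf : IsTestFunctionOffIdentity E f) :
    MemLp (divWeight N (γ / p) f) (ENNReal.ofReal p) μ ∧
    MemLp (divWeight N (α - m) ((𝔥.radialDeriv N)^[m + 1] f)) (ENNReal.ofReal p) μ ∧
    MemLp (divWeight N (β / (p - 1) - k) ((𝔥.radialDeriv N)^[k] f)) (ENNReal.ofReal p) μ ∧
    |𝔥.Q - γ| / p * realLpNorm p μ (divWeight N (γ / p) f) ^ p ≤
      (p ^ m * (∏ j ∈ Finset.range m, |𝔥.Q - p * (α - j)|)⁻¹) *
      (p ^ ((k : ℝ) * (p - 1)) *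
        (∏ j ∈ Finset.range k, |𝔥.Q - p * (β / (p - 1) - j)|) ^ (-(p - 1))) *
      realLpNorm p μ (divWeight N (α - m) ((𝔥.radialDeriv N)^[m + 1] f)) *
      realLpNorm p μ (divWeight N (β / (p - 1) - k) ((𝔥.radialDeriv N)^[k] f)) ^ (p - 1) := by
  have hp0 : 0 < p := one_pos.trans hp
  have hp1 : 0 < p - 1 := sub_pos.2 hp
  have hf0 : mulWeight N 0 f = f := by
    funext x
    simp [mulWeight]
  have hmem := fun (s : ℝ) (j : ℕ) =>
    hN.memLp_divWeight_radialDeriv_iterate μ (ENNReal.ofReal p) hf 0 s j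
  rw [hf0] at hmem
  refine ⟨hmem (γ / p) 0, hmem _ _, hmem _ _, ?_⟩
  have hCKN := hN.caffarelliKohnNirenberg μ hp hf 0 α β γ hγ
  have hHβ := hN.hardy_iterate μ hp hf 0 (β / (p - 1)) k
  have hRf := hN.radialDeriv_mulWeight hf 0
  -- the Hardy inequality is iterated on `𝓡 f = |x|^(-1) 𝔼 f`
  have hHα := hN.hardy_iterate μ hp
    ((𝔥.isTestFunctionOffIdentity_eulerDeriv hf).add_const_mul hf (0 : ℝ)) (0 - 1) α m
  rw [← hRf] at hHα
  rw [hf0] at hCKN hHβ hHα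
  rw [← Function.iterate_succ_apply] at hHα
  set Pα := ∏ j ∈ Finset.range m, |𝔥.Q - p * (α - j)| with hPα
  set Pβ := ∏ j ∈ Finset.range k, |𝔥.Q - p * (β / (p - 1) - j)| with hPβ
  have hPα0 : 0 < Pα := (Finset.prod_nonneg fun _ _ => abs_nonneg _).lt_of_ne' hα
  have hPβ0 : 0 < Pβ := (Finset.prod_nonneg fun _ _ => abs_nonneg _).lt_of_ne' hβ
  rw [← le_inv_mul_iff₀ hPα0] at hHα
  rw [← le_inv_mul_iff₀ hPβ0] at hHβ
  set Zβ := realLpNorm p μ (divWeight N (β / (p - 1) - k) ((𝔥.radialDeriv N)^[k] f)) with hZβ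
  have hZ0 : 0 ≤ Zβ := ENNReal.toReal_nonneg
  have hpow : (Pβ⁻¹ * (p ^ k * Zβ)) ^ (p - 1) =
      p ^ ((k : ℝ) * (p - 1)) * Pβ ^ (-(p - 1)) * Zβ ^ (p - 1) := by
    rw [Real.mul_rpow (by positivity) (by positivity), Real.mul_rpow (by positivity) hZ0,
      Real.inv_rpow hPβ0.le, ← Real.rpow_neg hPβ0.le, Real.rpow_mul hp0.le, Real.rpow_natCast]
    ring
  refine hCKN.trans ((mul_le_mul hHα (Real.rpow_le_rpow ENNReal.toReal_nonneg hHβ hp1.le)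
    (Real.rpow_nonneg ENNReal.toReal_nonneg _)
    (mul_nonneg (by positivity) (mul_nonneg (by positivity) ENNReal.toReal_nonneg))).trans_eq ?_)
  rw [hpow]
  ring
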